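/- Let $q,a,b$ be real with $|q|<1$ and $|b|<|a|$. Put $[n]_q=1+q+\dots+q^{n-1}$, $[n]_q!=\prod_{j=1}^n[j]_q$, $(c)_\infty=\prod_{k\ge0}(1-cq^k)$ and $S(q)=[-2/\sqrt{1-q},\,2/\sqrt{1-q}]$. Let $H_n(x|a,q)$ be the big $q$-Hermite polynomials, defined by $H_{-1}=0$, $H_0=1$ and $$H_{n+1}(x|a,q)=(x-aq^n)H_n(x|a,q)-[n]_qH_{n-1}(x|a,q)\qquad(n\ge0);$$ equivalently $H_n(x|a,q)=(1-q)^{-n/2}h_n\bigl(\tfrac{x\sqrt{1-q}}2\,\big|\,a\sqrt{1-q},q\bigr)$, where $h_{-1}=0$, $h_0=1$ and $(2x-aq^n)h_n(x|a,q)=h_{n+1}(x|a,q)+(1-q^n)h_{n-1}(x|a,q)$. Let $$V_q(x|c)=1-(1-q)cx+(1-q)c^2,\qquad W_q(x,y|t)=(1-t^2)^2-(1-q)xyt(1+t^2)+(1-q)t^2(x^2+y^2).$$ Then for all $x,y\in S(q)$ the series and the infinite products below converge, every $W_q\bigl(x,y\,|\,\tfrac ba q^k\bigr)$ with $k\ge0$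 is nonzero, and $$0\le\sum_{n\ge0}\frac{b^n}{[n]_q!\,a^n}H_n(x|a,q)H_n(y|b,q)=\Bigl(\frac{b^2}{a^2}\Bigr)_\infty\prod_{k=0}^\infty\frac{V_q(y\,|\,bq^k)}{W_q\bigl(x,y\,|\,\tfrac ba q^k\bigr)}.$$ -/

import Mathlib

noncomputable section

namespace BigQHermite

/-- The interval `S(q) = [-2/√(1-q), 2/√(1-q)]`. -/
def S (q : ℝ) : Set ℝ := Set.Icc (-2 / √(1 - q)) (2 / √(1 - q))

/-- The `q`-number `[n]_q = 1 + q + ... + q^(n-1)`, with `[0]_q = 0`. -/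
def qNumber (q : ℝ) (n : ℕ) : ℝ := ∑ i ∈ Finset.range n, q ^ i

/-- The `q`-factorial `[n]_q! = [1]_q [2]_q ... [n]_q`, with `[0]_q! = 1`. -/
def qFactorial (q : ℝ) (n : ℕ) : ℝ := ∏ j ∈ Finset.range n, qNumber q (j + 1)

/-- The infinite `q`-Pochhammer symbol `(a)_∞ = ∏_{k ≥ 0} (1 - a q^k)`. -/
def qPochhammerInf (a q : ℝ) : ℝ := ∏' k : ℕ, (1 - a * q ^ k)

/-- The big continuous `q`-Hermite polynomials `h_n(x|a,q)` supported on `[-1,1]`: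
`h_{-1} = 0`, `h_0 = 1`, `h_{n+1} = (2x - a q^n) h_n - (1 - q^n) h_{n-1}`. -/
def littleH (a q x : ℝ) : ℕ → ℝ
  | 0 => 1
  | 1 => 2 * x - a
  | n + 2 => (2 * x - a * q ^ (n + 1)) * littleH a q x (n + 1)
      - (1 - q ^ (n + 1)) * littleH a q x n

/-- The big `q`-Hermite polynomials rescaled to `S(q)`:
`H_n(x|a,q) = (1-q)^(-n/2) h_n(x√(1-q)/2 | a√(1-q), q)`, i.e. the monic polynomials with
`H_{n+1} = (x - a q^n) H_n - [n]_q H_{n-1}`, `H_{-1} = 0`, `H_0 = 1`. -/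
def bigH (n : ℕ) (x a q : ℝ) : ℝ :=
  (√(1 - q) ^ n)⁻¹ * littleH (a * √(1 - q)) q (x * √(1 - q) / 2) n

/-- `v(x|a) = 1 - 2ax + a²`. -/
def v (x a : ℝ) : ℝ := 1 - 2 * a * x + a ^ 2

/-- `w(x,y|a) = (1-a²)² - 4xya(1+a²) + 4a²(x²+y²)`. -/
def w (x y a : ℝ) : ℝ :=
  (1 - a ^ 2) ^ 2 - 4 * x * y * a * (1 + a ^ 2) + 4 * a ^ 2 * (x ^ 2 + y ^ 2)

/-- `V_q(x|a) = v(x√(1-q)/2 | a√(1-q)) = 1 - (1-q)ax + (1-q)a²` for `q ≤ 1`. -/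
def V (q x a : ℝ) : ℝ := v (x * √(1 - q) / 2) (a * √(1 - q))

/-- `W_q(x,y|t) = w(x√(1-q)/2, y√(1-q)/2 | t)
= (1-t²)² - (1-q)xyt(1+t²) + (1-q)t²(x²+y²)` for `q ≤ 1`. -/
def W (q x y t : ℝ) : ℝ := w (x * √(1 - q) / 2) (y * √(1 - q) / 2) t

/-- The `n`-th term `b^n / ([n]_q! a^n) H_n(x|a,q) H_n(y|b,q)` of the kernel. -/
def kernelTerm (q a b x y : ℝ) (n : ℕ) : ℝ :=
  b ^ n / (qFactorial q n * a ^ n) * bigH n x a q * bigH n y b q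

end BigQHermite

end

/-!
Write `⟨F, G⟩_t = ∑ tⁿ / (q;q)_n F_n G_n`. For this pairing `F ↦ (1 - qⁿ) F_{n-1}` is adjoint to
`t` times the shift `G ↦ G_{n+1}`. Two contiguous relations between the `h_n(x|a,q)` and the
`h_n(x|aq,q)` then give, for the kernel `⟨h(x|a), h(y|b)⟩_t` at `b = ta`, an exact factor
`v(y|ta)` when `(a, b)` is replaced by `(aq, bq)`. Iterating removes the parameters `a` and `b`. At
`a = b = 0` the three-term recurrence gives the functional equation
`w(x,y|t) K(t) = (1 - t²)(1 - qt²) K(tq)`, whose iteration is the Poisson–Mehler formula. Both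
iterations converge because `h_n` grows at most linearly in `n` on `[-1, 1]`, locally uniformly
in `a`. Finally, every factor of the closed form is nonnegative, since at `x = cos θ`, `y = cos φ`
one has `w(x,y|t) = v(cos (θ + φ)|t) v(cos (θ - φ)|t)`.
-/

namespace BigQHermite

open Filter Topology

/-! ### Infinite products -/

lemma eq_tprod_mul_of_eq_mul_succ {M : Type*} [CommMonoid M] [TopologicalSpace M]
    [ContinuousMul M] [T2Space M] {f c : ℕ → M} {l : M} (hc : Multipliable c)
    (hstep : ∀ n, f n = c n * f (n + 1)) (hf : Tendsto f atTop (𝓝 l)) :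
    f 0 = (∏' n, c n) * l := by
  have iterate (n : ℕ) : f 0 = (∏ k ∈ Finset.range n, c k) * f n := by
    induction n with
    | zero => simp
    | succ n ih => rw [ih, hstep n, Finset.prod_range_succ, mul_assoc]
  exact tendsto_nhds_unique (tendsto_const_nhds.congr iterate)
    (hc.tendsto_prod_tprod_nat.mul hf)

lemma exists_norm_prod_range_le {R : Type*} [SeminormedCommRing R] {f : ℕ → R}
    (hf : Multipliable f) : ∃ C, ∀ n, ‖∏ k ∈ Finset.range n, f k‖ ≤ C := by
  obtain ⟨C, hC⟩ :=
    (Metric.isBounded_range_of_tendsto _ hf.tendsto_prod_tprod_nat).exists_norm_le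
  exact ⟨C, fun n => hC _ (Set.mem_range_self n)⟩

section NormedField

variable {𝕜 : Type*} [NontriviallyNormedField 𝕜]

lemma tendsto_const_mul_pow {q : 𝕜} (hq : ‖q‖ < 1) (c : 𝕜) :
    Tendsto (fun k : ℕ => c * q ^ k) atTop (𝓝 0) := by
  simpa only [mul_zero] using (tendsto_pow_atTop_nhds_zero_of_norm_lt_one hq).const_mul c

lemma multipliable_comp_mul_pow {R : Type*} [NormedCommRing R] [NormOneClass R]
    [NormedSpace 𝕜 R] [CompleteSpace R] {f : 𝕜 → R} (hf : DifferentiableAt 𝕜 f 0)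
    (hf0 : f 0 = 1) {q : 𝕜} (hq : ‖q‖ < 1) (c : 𝕜) :
    Multipliable fun k : ℕ => f (c * q ^ k) := by
  have hO : (fun k : ℕ => f (c * q ^ k) - 1) =O[atTop] fun k : ℕ => ‖q‖ ^ k := by
    have h := hf.isBigO_sub.comp_tendsto (tendsto_const_mul_pow hq c)
    simp only [hf0, sub_zero, Function.comp_def] at h
    refine h.trans (Asymptotics.IsBigO.of_bound ‖c‖ (Eventually.of_forall fun k => ?_))
    rw [norm_mul, norm_pow, norm_pow, norm_norm]
  have hsum : Summable fun k : ℕ => ‖f (c * q ^ k) - 1‖ :=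
    summable_of_isBigO_nat (summable_geometric_of_lt_one (norm_nonneg q) hq) hO.norm_left
  simpa only [add_sub_cancel] using multipliable_one_add_of_summable hsum

/-! ### The pairing with weights `t ^ n / (q; q)_n` -/

/-- The coefficient `tⁿ / (q;q)_n` of the `q`-exponential series. -/
noncomputable def qExpCoeff (q t : 𝕜) (n : ℕ) : 𝕜 := t ^ n / ∏ j ∈ Finset.range n, (1 - q ^ (j + 1))

/-- The pairing `⟨F, G⟩_t = ∑ tⁿ / (q;q)_n F_n G_n` of two sequences. It has the junk value `0` if
the series diverges. -/
noncomputable def qPairing (q t : 𝕜) (F G : ℕ → 𝕜) : 𝕜 := ∑' n, qExpCoeff q t n * (F n * G n)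

/-- At most polynomial growth of a sequence, the growth condition under which the series
`qPairing` are manipulated. The bound uses `n + 1` so that it also covers `n = 0`. -/
def PolynomiallyBounded (F : ℕ → 𝕜) : Prop := ∃ (C : ℝ) (k : ℕ), ∀ n, ‖F n‖ ≤ C * (n + 1) ^ k

lemma PolynomiallyBounded.mul {F G : ℕ → 𝕜} (hF : PolynomiallyBounded F)
    (hG : PolynomiallyBounded G) : PolynomiallyBounded fun n => F n * G n := by
  obtain ⟨C, k, hC⟩ := hF
  obtain ⟨D, m, hD⟩ := hG
  refine ⟨C * D, k + m, fun n => ?_⟩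
  calc ‖F n * G n‖ = ‖F n‖ * ‖G n‖ := norm_mul _ _
    _ ≤ (C * (n + 1) ^ k) * (D * (n + 1) ^ m) :=
      mul_le_mul (hC n) (hD n) (norm_nonneg _) ((norm_nonneg _).trans (hC n))
    _ = C * D * (n + 1) ^ (k + m) := by ring

lemma PolynomiallyBounded.comp_succ {F : ℕ → 𝕜} (hF : PolynomiallyBounded F) :
    PolynomiallyBounded fun n => F (n + 1) := by
  obtain ⟨C, k, hC⟩ := hF
  have hC0 : 0 ≤ C := by simpa using (norm_nonneg _).trans (hC 0)
  refine ⟨C * 2 ^ k, k, fun n => ?_⟩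
  calc ‖F (n + 1)‖ ≤ C * ((n + 1 : ℕ) + 1) ^ k := hC (n + 1)
    _ ≤ C * (2 * (n + 1)) ^ k := by gcongr; push_cast; linarith
    _ = C * 2 ^ k * (n + 1) ^ k := by rw [mul_pow, mul_assoc]

lemma summable_succ_pow_mul_geometric {r : ℝ} (hr0 : 0 ≤ r) (hr : r < 1) (k : ℕ) :
    Summable fun n : ℕ => ((n : ℝ) + 1) ^ k * r ^ n := by
  have hnorm : ‖r‖ < 1 := by rwa [Real.norm_of_nonneg hr0]
  have hsum := ((summable_pow_mul_geometric_of_norm_lt_one k hnorm).add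
    (summable_geometric_of_lt_one hr0 hr)).mul_left (2 ^ (k - 1))
  refine hsum.of_nonneg_of_le (fun n => by positivity) fun n => ?_
  calc ((n : ℝ) + 1) ^ k * r ^ n ≤ (2 ^ (k - 1) * ((n : ℝ) ^ k + 1 ^ k)) * r ^ n := by
        gcongr; exact add_pow_le n.cast_nonneg zero_le_one k
    _ = 2 ^ (k - 1) * ((n : ℝ) ^ k * r ^ n + r ^ n) := by rw [one_pow]; ring

lemma one_sub_pow_succ_ne_zero {q : 𝕜} (hq : ‖q‖ < 1) (n : ℕ) : 1 - q ^ (n + 1) ≠ 0 := by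
  intro h
  have hlt : ‖q ^ (n + 1)‖ < 1 := by
    rw [norm_pow]; exact pow_lt_one₀ (norm_nonneg q) hq n.succ_ne_zero
  rw [← sub_eq_zero.1 h, norm_one] at hlt
  exact hlt.false

lemma qExpCoeff_succ_mul {q : 𝕜} (hq : ‖q‖ < 1) (t : 𝕜) (n : ℕ) :
    qExpCoeff q t (n + 1) * (1 - q ^ (n + 1)) = t * qExpCoeff q t n := by
  rw [qExpCoeff, qExpCoeff, Finset.prod_range_succ, ← div_div,
    div_mul_cancel₀ _ (one_sub_pow_succ_ne_zero hq n), pow_succ', mul_div_assoc]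

lemma qExpCoeff_mul (q t s : 𝕜) (n : ℕ) : qExpCoeff q (t * s) n = qExpCoeff q t n * s ^ n := by
  rw [qExpCoeff, qExpCoeff, mul_pow, mul_div_right_comm]

lemma qPairing_comm (q t : 𝕜) (F G : ℕ → 𝕜) : qPairing q t F G = qPairing q t G F := by
  simp only [qPairing, mul_comm (F _)]

lemma qPairing_zero_left (q : 𝕜) (F G : ℕ → 𝕜) : qPairing q 0 F G = F 0 * G 0 := by
  rw [qPairing, tsum_eq_single 0 fun n hn => by simp [qExpCoeff, hn]]
  simp [qExpCoeff]

lemma qPairing_one_sub_pow_mul_pred {q : 𝕜} (hq : ‖q‖ < 1) (t : 𝕜) (F G : ℕ → 𝕜) :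
    qPairing q t (fun n => (1 - q ^ n) * F (n - 1)) G =
      t * qPairing q t F fun n => G (n + 1) := by
  have hsupport : Function.support (fun n => qExpCoeff q t n * ((1 - q ^ n) * F (n - 1) * G n)) ⊆
      Set.range Nat.succ := by
    intro n hn
    refine Nat.exists_eq_succ_of_ne_zero (fun h0 => hn ?_) |>.imp fun _ => Eq.symm
    simp [h0]
  rw [qPairing, qPairing, ← Nat.succ_injective.tsum_eq hsupport, ← tsum_mul_left]
  refine tsum_congr fun n => ?_
  rw [Nat.succ_eq_add_one, Nat.add_sub_cancel]
  linear_combination F n * G (n + 1) * qExpCoeff_succ_mul hq t n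

section Complete

variable [CompleteSpace 𝕜] {q : 𝕜} (hq : ‖q‖ < 1)
include hq

lemma exists_norm_qExpCoeff_le : ∃ C, ∀ (t : 𝕜) (n : ℕ), ‖qExpCoeff q t n‖ ≤ C * ‖t‖ ^ n := by
  have hmul : Multipliable fun k : ℕ => (1 - q ^ (k + 1))⁻¹ := by
    have hdiff : DifferentiableAt 𝕜 (fun z : 𝕜 => (1 - q * z)⁻¹) 0 :=
      DifferentiableAt.inv (by fun_prop) (by simp)
    simpa only [one_mul, ← pow_succ'] using multipliable_comp_mul_pow hdiff (by simp) hq 1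
  obtain ⟨C, hC⟩ := exists_norm_prod_range_le hmul
  refine ⟨C, fun t n => ?_⟩
  rw [qExpCoeff, div_eq_mul_inv, ← Finset.prod_inv_distrib, norm_mul, norm_pow, mul_comm]
  gcongr
  exact hC n

lemma exists_summable_norm_qExpCoeff_mul_le {r : ℝ} (hr0 : 0 ≤ r) (hr : r < 1) (C : ℝ) (k : ℕ) :
    ∃ D : ℕ → ℝ, Summable D ∧ ∀ t z : 𝕜, ∀ n : ℕ,
      ‖t‖ ≤ r → ‖z‖ ≤ C * (n + 1) ^ k → ‖qExpCoeff q t n * z‖ ≤ D n := by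
  obtain ⟨K, hK⟩ := exists_norm_qExpCoeff_le hq
  have hK0 : 0 ≤ K := by simpa using (norm_nonneg _).trans (hK 0 0)
  refine ⟨_, (summable_succ_pow_mul_geometric hr0 hr k).mul_left (K * C), fun t z n ht hz => ?_⟩
  calc ‖qExpCoeff q t n * z‖ = ‖qExpCoeff q t n‖ * ‖z‖ := norm_mul _ _
    _ ≤ (K * r ^ n) * (C * (n + 1) ^ k) := by
      refine mul_le_mul ((hK t n).trans ?_) hz (norm_nonneg z) (by positivity)
      gcongr
    _ = K * C * ((n + 1) ^ k * r ^ n) := by ring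

lemma tendsto_tsum_qExpCoeff_mul {ι : Type*} {l : Filter ι} {s : ι → 𝕜} {F : ι → ℕ → 𝕜} {t : 𝕜}
    {G : ℕ → 𝕜} {C : ℝ} {k : ℕ} (ht : ‖t‖ < 1) (hs : Tendsto s l (𝓝 t))
    (hbound : ∀ᶠ i in l, ∀ n, ‖F i n‖ ≤ C * (n + 1) ^ k)
    (hF : ∀ n, Tendsto (F · n) l (𝓝 (G n))) :
    Tendsto (fun i => ∑' n, qExpCoeff q (s i) n * F i n) l (𝓝 (∑' n, qExpCoeff q t n * G n)) := by
  obtain ⟨r, htr, hr⟩ := exists_between ht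
  obtain ⟨D, hD, hle⟩ :=
    exists_summable_norm_qExpCoeff_mul_le hq ((norm_nonneg t).trans htr.le) hr C k
  refine tendsto_tsum_of_dominated_convergence hD
    (fun n => ((hs.pow n).div_const _).mul (hF n)) ?_
  filter_upwards [hs.norm.eventually_le_const htr, hbound] with i hi hFi n
  exact hle _ _ _ hi (hFi n)

variable {t : 𝕜} (ht : ‖t‖ < 1) {F G : ℕ → 𝕜} (hF : PolynomiallyBounded F)
  (hG : PolynomiallyBounded G)
include ht hF hG

lemma hasSum_qPairing : HasSum (fun n => qExpCoeff q t n * (F n * G n)) (qPairing q t F G) := by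
  obtain ⟨C, k, hC⟩ := hF.mul hG
  obtain ⟨D, hD, hle⟩ := exists_summable_norm_qExpCoeff_mul_le hq (norm_nonneg t) ht C k
  exact (Summable.of_norm_bounded hD fun n => hle _ _ _ le_rfl (hC n)).hasSum

lemma hasSum_qPairing_mul_q :
    HasSum (fun n => qExpCoeff q t n * (q ^ n * (F n * G n))) (qPairing q (t * q) F G) := by
  have htq : ‖t * q‖ < 1 := by
    rw [norm_mul]; exact mul_lt_one_of_nonneg_of_lt_one_left (norm_nonneg t) ht hq.le
  simpa only [qExpCoeff_mul, mul_assoc] using hasSum_qPairing hq htq hF hG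

lemma qPairing_mul_q :
    qPairing q (t * q) F G =
      qPairing q t F G - t * qPairing q t (fun n => F (n + 1)) fun n => G (n + 1) := by
  have hdiff := (hasSum_qPairing hq ht hF hG).sub (hasSum_qPairing_mul_q hq ht hF hG)
  have hpred : qPairing q t (fun n => (1 - q ^ n) * F (n - 1 + 1)) G = _ :=
    (hdiff.congr_fun fun n => by cases n <;> simp; ring).tsum_eq
  rw [qPairing_one_sub_pow_mul_pred hq t (fun n => F (n + 1)) G] at hpred
  linear_combination hpred

end Complete

end NormedField

/-! ### Linear growth of the polynomials on `[-1, 1]` -/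

/-- With `d_n = h_{n+1} - u h_n` the recurrence reads `d_{n+1} = w d_n + error`, so the bounds
`‖d_n‖ ≤ D_n` and `‖h_n‖ ≤ (n + 1) D_n` propagate together. -/
lemma norm_le_mul_prod_of_perturbed_recurrence {R : Type*} [SeminormedCommRing R] {u w : R}
    (hu : ‖u‖ ≤ 1) (hw : ‖w‖ ≤ 1) {h : ℕ → R} {η : ℕ → ℝ} (hη : ∀ n, 0 ≤ η n)
    (hrec : ∀ n, ‖h (n + 2) - (u + w) * h (n + 1) + u * w * h n‖ ≤ η n * (‖h n‖ + ‖h (n + 1)‖))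
    {C : ℝ} (hC₀ : ‖h 0‖ ≤ C) (hC₁ : ‖h 1 - u * h 0‖ ≤ C) (n : ℕ) :
    ‖h n‖ ≤ (n + 1) * (C * ∏ j ∈ Finset.range n, (1 + (2 * j + 3) * η j)) := by
  set D : ℕ → ℝ := fun n => C * ∏ j ∈ Finset.range n, (1 + (2 * j + 3) * η j) with hD
  suffices hboth : ‖h n‖ ≤ (n + 1) * D n ∧ ‖h (n + 1) - u * h n‖ ≤ D n from hboth.1
  induction n with
  | zero => simpa [hD] using ⟨hC₀, hC₁⟩
  | succ n ih =>
    obtain ⟨ihh, ihd⟩ := ih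
    have hD_succ : D (n + 1) = D n + (2 * n + 3) * η n * D n := by
      simp only [hD, Finset.prod_range_succ]; ring
    have hD_le : D n ≤ D (n + 1) := by
      have hDn : 0 ≤ D n := (norm_nonneg _).trans ihd
      have := hη n
      rw [hD_succ]; exact le_add_of_nonneg_right (by positivity)
    have hh : ‖h (n + 1)‖ ≤ (n + 2) * D n := calc
      ‖h (n + 1)‖ = ‖u * h n + (h (n + 1) - u * h n)‖ := by rw [add_sub_cancel]
      _ ≤ ‖u‖ * ‖h n‖ + ‖h (n + 1) - u * h n‖ :=
        (norm_add_le _ _).trans (by gcongr; exact norm_mul_le _ _)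
      _ ≤ 1 * ((n + 1) * D n) + D n := by gcongr
      _ = (n + 2) * D n := by ring
    have hd : ‖h (n + 2) - u * h (n + 1)‖ ≤ D (n + 1) := calc
      ‖h (n + 2) - u * h (n + 1)‖ = ‖w * (h (n + 1) - u * h n)
          + (h (n + 2) - (u + w) * h (n + 1) + u * w * h n)‖ := by congr 1; ring
      _ ≤ ‖w‖ * ‖h (n + 1) - u * h n‖ + η n * (‖h n‖ + ‖h (n + 1)‖) :=
        (norm_add_le _ _).trans (add_le_add (norm_mul_le _ _) (hrec n))
      _ ≤ 1 * D n + η n * ((n + 1) * D n + (n + 2) * D n) := by gcongr; exact hη n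
      _ = D (n + 1) := by rw [hD_succ]; ring
    refine ⟨hh.trans ?_, hd⟩
    push_cast
    rw [add_assoc, one_add_one_eq_two]
    gcongr

lemma exists_norm_eq_one_add_eq_mul_eq_one {x : ℝ} (hx : |x| ≤ 1) :
    ∃ u w : ℂ, ‖u‖ = 1 ∧ ‖w‖ = 1 ∧ u + w = 2 * x ∧ u * w = 1 := by
  obtain ⟨h₁, h₂⟩ := abs_le.1 hx
  set θ := Real.arccos x
  refine ⟨Complex.exp (θ * Complex.I), Complex.exp ((-θ : ℝ) * Complex.I),
    Complex.norm_exp_ofReal_mul_I _, Complex.norm_exp_ofReal_mul_I _, ?_, ?_⟩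
  · rw [Complex.ofReal_neg, ← Complex.two_cos, ← Complex.ofReal_cos, Real.cos_arccos h₁ h₂]
  · rw [← Complex.exp_add, Complex.ofReal_neg, neg_mul, add_neg_cancel, Complex.exp_zero]

lemma littleH_succ (a q x : ℝ) (n : ℕ) :
    littleH a q x (n + 1) =
      (2 * x - a * q ^ n) * littleH a q x n - (1 - q ^ n) * littleH a q x (n - 1) := by
  cases n <;> simp [littleH]

lemma abs_littleH_le_mul_prod {q A a x : ℝ} (ha : |a| ≤ A) (hx : |x| ≤ 1) (n : ℕ) :
    |littleH a q x n| ≤ (n + 1) *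
      ((1 + A) * ∏ j ∈ Finset.range n, (1 + (2 * j + 3) * ((1 + A) * |q| ^ (j + 1)))) := by
  have hA : 0 ≤ A := (abs_nonneg a).trans ha
  obtain ⟨u, w, hu, hw, hadd, hmul⟩ := exists_norm_eq_one_add_eq_mul_eq_one hx
  have hrec (n : ℕ) : ‖(littleH a q x (n + 2) : ℂ) - (u + w) * littleH a q x (n + 1)
      + u * w * littleH a q x n‖ ≤ (1 + A) * |q| ^ (n + 1) *
        (‖(littleH a q x n : ℂ)‖ + ‖(littleH a q x (n + 1) : ℂ)‖) := by
    have herror : (littleH a q x (n + 2) : ℂ) - (u + w) * littleH a q x (n + 1)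
        + u * w * littleH a q x n =
        ((q ^ (n + 1) * (littleH a q x n - a * littleH a q x (n + 1)) : ℝ) : ℂ) := by
      rw [hadd, hmul, littleH]; push_cast; ring
    simp only [herror, Complex.norm_real, Real.norm_eq_abs, abs_mul, abs_pow]
    calc |q| ^ (n + 1) * |littleH a q x n - a * littleH a q x (n + 1)|
        ≤ |q| ^ (n + 1) * (|littleH a q x n| + A * |littleH a q x (n + 1)|) := by
          gcongr; refine (abs_sub _ _).trans ?_; rw [abs_mul]; gcongr
      _ ≤ |q| ^ (n + 1) * ((1 + A) * (|littleH a q x n| + |littleH a q x (n + 1)|)) := by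
          gcongr
          nlinarith [abs_nonneg (littleH a q x n), abs_nonneg (littleH a q x (n + 1)),
            mul_nonneg hA (abs_nonneg (littleH a q x n))]
      _ = _ := by ring
  have hC₁ : ‖(littleH a q x 1 : ℂ) - u * littleH a q x 0‖ ≤ 1 + A := calc
    _ = ‖w - a‖ := by congr 1; simp only [littleH]; push_cast; linear_combination -hadd
    _ ≤ 1 + A := (norm_sub_le _ _).trans (by rw [hw, Complex.norm_real]; gcongr; exact ha)
  have := norm_le_mul_prod_of_perturbed_recurrence hu.le hw.le
    (h := fun n => (littleH a q x n : ℂ)) (fun n => by positivity) hrec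
    (by simpa [littleH] using hA) hC₁ n
  rwa [Complex.norm_real] at this

lemma exists_abs_littleH_le {q : ℝ} (hq : |q| < 1) (A : ℝ) :
    ∃ C, ∀ a x : ℝ, |a| ≤ A → |x| ≤ 1 → ∀ n : ℕ, |littleH a q x n| ≤ C * (n + 1) := by
  have hmul : Multipliable fun j : ℕ => 1 + (2 * (j : ℝ) + 3) * ((1 + A) * |q| ^ (j + 1)) := by
    have hq' : ‖|q|‖ < 1 := by rwa [Real.norm_eq_abs, abs_abs]
    have hsum := (((summable_pow_mul_geometric_of_norm_lt_one 1 hq').mul_left 2).add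
      ((summable_geometric_of_lt_one (abs_nonneg q) hq).mul_left 3)).mul_left ((1 + A) * |q|)
    refine Real.multipliable_one_add_of_summable (hsum.congr fun j => ?_)
    ring
  obtain ⟨C, hC⟩ := exists_norm_prod_range_le hmul
  refine ⟨(1 + A) * C, fun a x ha hx n => (abs_littleH_le_mul_prod ha hx n).trans ?_⟩
  have hA : 0 ≤ A := (abs_nonneg a).trans ha
  rw [mul_comm]
  gcongr
  exact (le_abs_self _).trans (hC n)

lemma polynomiallyBounded_littleH {q : ℝ} (hq : |q| < 1) (a : ℝ) {x : ℝ} (hx : |x| ≤ 1) :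
    PolynomiallyBounded (littleH a q x) := by
  obtain ⟨C, hC⟩ := exists_abs_littleH_le hq |a|
  exact ⟨C, 1, fun n => by simpa using hC a x le_rfl hx n⟩

/-! ### Recurrences as identities for the pairing -/

lemma littleH_eq_littleH_mul (a q x : ℝ) (n : ℕ) :
    littleH a q x n =
      littleH (a * q) q x n - a * ((1 - q ^ n) * littleH (a * q) q x (n - 1)) := by
  induction n using Nat.twoStepInduction with
  | zero => simp [littleH]
  | one => simp [littleH]; ring
  | more n h₀ h₁ =>
    have e₀ := littleH_succ (a * q) q x n
    rw [littleH, h₁, h₀, littleH, Nat.add_sub_cancel, Nat.succ_sub_one]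
    linear_combination a * (1 - q ^ (n + 1)) * e₀

lemma littleH_succ_eq_littleH_mul (a q x : ℝ) (n : ℕ) :
    littleH a q x (n + 1) =
      (2 * x - a) * littleH (a * q) q x n - (1 - q ^ n) * littleH (a * q) q x (n - 1) := by
  rw [littleH_eq_littleH_mul, littleH_succ, Nat.add_sub_cancel]
  ring

section Pairing

variable {q t a x : ℝ} {G : ℕ → ℝ} (hq : |q| < 1) (ht : |t| < 1) (hx : |x| ≤ 1)
  (hG : PolynomiallyBounded G)
include hq ht hx hG

lemma qPairing_littleH_succ :
    qPairing q t (fun n => littleH a q x (n + 1)) G =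
      2 * x * qPairing q t (littleH a q x) G - a * qPairing q (t * q) (littleH a q x) G
        - t * qPairing q t (littleH a q x) fun n => G (n + 1) := by
  have hh := polynomiallyBounded_littleH hq a hx
  have hsum := (((hasSum_qPairing hq ht hh hG).mul_left (2 * x)).sub
    ((hasSum_qPairing_mul_q hq ht hh hG).mul_left a)).sub
      (hasSum_qPairing hq ht hh.comp_succ hG)
  have hpred : qPairing q t (fun n => (1 - q ^ n) * littleH a q x (n - 1)) G = _ :=
    (hsum.congr_fun fun n => by rw [littleH_succ]; ring).tsum_eq
  rw [qPairing_one_sub_pow_mul_pred hq] at hpred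
  linear_combination hpred

lemma qPairing_littleH_add_two :
    qPairing q t (fun n => littleH a q x (n + 2)) G =
      2 * x * qPairing q t (fun n => littleH a q x (n + 1)) G
        - a * q * qPairing q (t * q) (fun n => littleH a q x (n + 1)) G
        - (qPairing q t (littleH a q x) G - q * qPairing q (t * q) (littleH a q x) G) := by
  have hh := polynomiallyBounded_littleH hq a hx
  have hsum := (((hasSum_qPairing hq ht hh.comp_succ hG).mul_left (2 * x)).sub
    ((hasSum_qPairing_mul_q hq ht hh.comp_succ hG).mul_left (a * q))).sub
      ((hasSum_qPairing hq ht hh hG).sub ((hasSum_qPairing_mul_q hq ht hh hG).mul_left q))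
  exact (hsum.congr_fun fun n => by simp only [littleH]; ring).tsum_eq

lemma qPairing_littleH_eq_littleH_mul :
    qPairing q t (littleH a q x) G =
      qPairing q t (littleH (a * q) q x) G
        - a * t * qPairing q t (littleH (a * q) q x) fun n => G (n + 1) := by
  have hsum := (hasSum_qPairing hq ht (polynomiallyBounded_littleH hq (a * q) hx) hG).sub
    (hasSum_qPairing hq ht (polynomiallyBounded_littleH hq a hx) hG)
  have hpred : qPairing q t (fun n => (1 - q ^ n) * (a * littleH (a * q) q x (n - 1))) G = _ :=
    (hsum.congr_fun fun n => by rw [littleH_eq_littleH_mul a]; ring).tsum_eq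
  rw [qPairing_one_sub_pow_mul_pred hq t (fun n => a * littleH (a * q) q x n)] at hpred
  have hmul : qPairing q t (fun n => a * littleH (a * q) q x n) (fun n => G (n + 1)) =
      a * qPairing q t (littleH (a * q) q x) fun n => G (n + 1) := by
    simp only [qPairing, ← tsum_mul_left, mul_assoc, mul_left_comm a]
  linear_combination hpred - t * hmul

lemma qPairing_littleH_succ_eq_littleH_mul :
    qPairing q t (fun n => littleH a q x (n + 1)) G =
      (2 * x - a) * qPairing q t (littleH (a * q) q x) G
        - t * qPairing q t (littleH (a * q) q x) fun n => G (n + 1) := by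
  have hsum := ((hasSum_qPairing hq ht
    (polynomiallyBounded_littleH hq (a * q) hx) hG).mul_left (2 * x - a)).sub
      (hasSum_qPairing hq ht (polynomiallyBounded_littleH hq a hx).comp_succ hG)
  have hpred : qPairing q t (fun n => (1 - q ^ n) * littleH (a * q) q x (n - 1)) G = _ :=
    (hsum.congr_fun fun n => by rw [littleH_succ_eq_littleH_mul]; ring).tsum_eq
  rw [qPairing_one_sub_pow_mul_pred hq] at hpred
  linear_combination hpred

end Pairing

/-! ### Positivity of the factors -/

lemma v_eq_sq_add (c t : ℝ) : v c t = (1 - t * c) ^ 2 + t ^ 2 * (1 - c ^ 2) := by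
  rw [v]; ring

lemma v_nonneg {c : ℝ} (hc : |c| ≤ 1) (t : ℝ) : 0 ≤ v c t := by
  have := sub_nonneg.2 ((sq_le_one_iff_abs_le_one c).2 hc)
  rw [v_eq_sq_add]; positivity

lemma v_pos {c t : ℝ} (hc : |c| ≤ 1) (ht : |t| < 1) : 0 < v c t := by
  have hc' := sub_nonneg.2 ((sq_le_one_iff_abs_le_one c).2 hc)
  have htc : t * c < 1 := (le_abs_self _).trans_lt <| by
    rw [abs_mul]; exact mul_lt_one_of_nonneg_of_lt_one_left (abs_nonneg t) ht hc
  have := sub_pos.2 htc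
  rw [v_eq_sq_add]; positivity

lemma w_cos_cos (θ φ t : ℝ) :
    w (Real.cos θ) (Real.cos φ) t = v (Real.cos (θ + φ)) t * v (Real.cos (θ - φ)) t := by
  rw [Real.cos_add, Real.cos_sub, w, v, v]
  linear_combination 4 * t ^ 2 * Real.sin φ ^ 2 * Real.sin_sq_add_cos_sq θ
    + 4 * t ^ 2 * (1 - Real.cos θ ^ 2) * Real.sin_sq_add_cos_sq φ

lemma w_pos {x y t : ℝ} (hx : |x| ≤ 1) (hy : |y| ≤ 1) (ht : |t| < 1) : 0 < w x y t := by
  obtain ⟨hx₁, hx₂⟩ := abs_le.1 hx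
  obtain ⟨hy₁, hy₂⟩ := abs_le.1 hy
  rw [← Real.cos_arccos hx₁ hx₂, ← Real.cos_arccos hy₁ hy₂, w_cos_cos]
  exact mul_pos (v_pos (Real.abs_cos_le_one _) ht) (v_pos (Real.abs_cos_le_one _) ht)

/-! ### The infinite products of the closed form -/

lemma abs_mul_pow_le {q : ℝ} (hq : |q| ≤ 1) (c : ℝ) (k : ℕ) : |c * q ^ k| ≤ |c| := by
  rw [abs_mul, abs_pow]
  exact mul_le_of_le_one_right (abs_nonneg c) (pow_le_one₀ (abs_nonneg q) hq)

lemma multipliable_one_sub_mul_pow {q : ℝ} (hq : |q| < 1) (c : ℝ) :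
    Multipliable fun k : ℕ => 1 - c * q ^ k :=
  multipliable_comp_mul_pow (f := fun z => 1 - z) (by fun_prop) (by simp) hq c

lemma qPochhammerInf_nonneg {c q : ℝ} (hc : |c| ≤ 1) (hq : |q| ≤ 1) : 0 ≤ qPochhammerInf c q :=
  tprod_nonneg fun k => sub_nonneg.2 <|
    (le_abs_self _).trans ((abs_mul_pow_le hq c k).trans hc)

lemma multipliable_one_sub_mul_pow_even {q : ℝ} (hq : |q| < 1) (c : ℝ) :
    Multipliable fun k : ℕ => 1 - c * q ^ (2 * k) := by
  have hq2 : |q ^ 2| < 1 := by rw [abs_pow]; exact pow_lt_one₀ (abs_nonneg q) hq two_ne_zero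
  simpa only [pow_mul] using multipliable_one_sub_mul_pow hq2 c

lemma multipliable_one_sub_mul_pow_odd {q : ℝ} (hq : |q| < 1) (c : ℝ) :
    Multipliable fun k : ℕ => 1 - c * q ^ (2 * k + 1) := by
  simpa only [pow_succ', mul_assoc] using multipliable_one_sub_mul_pow_even hq (c * q)

lemma qPochhammerInf_eq_tprod_even_mul_odd {q : ℝ} (hq : |q| < 1) (c : ℝ) :
    qPochhammerInf c q = ∏' k : ℕ, (1 - c * q ^ (2 * k)) * (1 - c * q ^ (2 * k + 1)) := by
  have heven := multipliable_one_sub_mul_pow_even hq c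
  have hodd := multipliable_one_sub_mul_pow_odd hq c
  rw [heven.tprod_mul hodd]
  exact (tprod_even_mul_odd (f := fun k => 1 - c * q ^ k) heven hodd).symm

lemma multipliable_v {q : ℝ} (hq : |q| < 1) (y c : ℝ) :
    Multipliable fun k : ℕ => v y (c * q ^ k) :=
  multipliable_comp_mul_pow (f := v y) (by unfold v; fun_prop) (by simp [v]) hq c

lemma multipliable_w_inv {q : ℝ} (hq : |q| < 1) (x y c : ℝ) :
    Multipliable fun k : ℕ => (w x y (c * q ^ k))⁻¹ :=
  multipliable_comp_mul_pow (f := fun z => (w x y z)⁻¹)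
    (DifferentiableAt.inv (by unfold w; fun_prop) (by simp [w])) (by simp [w]) hq c

/-! ### The bilinear sum and its functional equations -/

/-- The bilinear sum `∑ tⁿ / (q;q)_n h_n(x|a,q) h_n(y|b,q)`; the kernel of the theorem is its
rescaled value at `t = b / a`. -/
noncomputable def bilinearSum (q t a b x y : ℝ) : ℝ :=
  qPairing q t (littleH a q x) (littleH b q y)

lemma continuous_littleH (q x : ℝ) (n : ℕ) : Continuous fun a => littleH a q x n := by
  induction n using Nat.twoStepInduction with
  | zero => simpa only [littleH] using continuous_const
  | one => simp only [littleH]; fun_prop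
  | more n h₀ h₁ => simp only [littleH]; fun_prop

section BilinearSum

variable {q t x y : ℝ} (hq : |q| < 1) (ht : |t| < 1) (hx : |x| ≤ 1) (hy : |y| ≤ 1)
include hq ht hx hy

lemma tendsto_bilinearSum {ι : Type*} {l : Filter ι} {s α β : ι → ℝ} {a b : ℝ}
    (hs : Tendsto s l (𝓝 t)) (hα : Tendsto α l (𝓝 a)) (hβ : Tendsto β l (𝓝 b)) :
    Tendsto (fun i => bilinearSum q (s i) (α i) (β i) x y) l (𝓝 (bilinearSum q t a b x y)) := by
  obtain ⟨C, hC⟩ := exists_abs_littleH_le hq (|a| + 1)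
  obtain ⟨D, hD⟩ := exists_abs_littleH_le hq (|b| + 1)
  refine tendsto_tsum_qExpCoeff_mul hq ht hs (C := C * D) (k := 2) ?_ fun n =>
    (((continuous_littleH q x n).tendsto a).comp hα).mul
      (((continuous_littleH q y n).tendsto b).comp hβ)
  filter_upwards [hα.abs.eventually_le_const (lt_add_one |a|),
    hβ.abs.eventually_le_const (lt_add_one |b|)] with i hαi hβi n
  calc ‖littleH (α i) q x n * littleH (β i) q y n‖
      = |littleH (α i) q x n| * |littleH (β i) q y n| := abs_mul _ _
    _ ≤ (C * (n + 1)) * (D * (n + 1)) :=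
      mul_le_mul (hC _ _ hαi hx n) (hD _ _ hβi hy n) (abs_nonneg _)
        ((abs_nonneg _).trans (hC _ _ hαi hx n))
    _ = C * D * (n + 1) ^ 2 := by ring

lemma bilinearSum_eq_v_mul (a : ℝ) :
    bilinearSum q t a (t * a) x y =
      v y (t * a) * bilinearSum q t (a * q) (t * a * q) x y := by
  have hh := polynomiallyBounded_littleH hq (a * q) hx
  have eliminate_a := qPairing_littleH_eq_littleH_mul (a := a) hq ht hx
    (polynomiallyBounded_littleH hq (t * a) hy)
  have eliminate_b := qPairing_littleH_eq_littleH_mul (a := t * a) hq ht hy hh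
  have eliminate_b_succ := qPairing_littleH_succ_eq_littleH_mul (a := t * a) hq ht hy hh
  rw [qPairing_comm q t _ (littleH (a * q) q x)] at eliminate_b eliminate_b_succ
  rw [qPairing_comm q t _ (littleH (a * q) q x)] at eliminate_b eliminate_b_succ
  simp only [bilinearSum, v]
  linear_combination eliminate_a + eliminate_b - a * t * eliminate_b_succ

lemma w_mul_bilinearSum_zero_zero :
    w x y t * bilinearSum q t 0 0 x y =
      (1 - t ^ 2) * (1 - t ^ 2 * q) * bilinearSum q (t * q) 0 0 x y := by
  set h := littleH 0 q x
  set g := littleH 0 q y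
  have hh : PolynomiallyBounded h := polynomiallyBounded_littleH hq 0 hx
  have hg : PolynomiallyBounded g := polynomiallyBounded_littleH hq 0 hy
  have shift_h : qPairing q t (fun n => h (n + 1)) g =
      2 * x * qPairing q t h g - t * qPairing q t h fun n => g (n + 1) := by
    simpa using qPairing_littleH_succ (a := 0) hq ht hx hg
  have shift_g : qPairing q t h (fun n => g (n + 1)) =
      2 * y * qPairing q t h g - t * qPairing q t (fun n => h (n + 1)) g := by
    rw [qPairing_comm q t h fun n => g (n + 1), qPairing_comm q t h g,
      qPairing_comm q t (fun n => h (n + 1)) g]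
    simpa using qPairing_littleH_succ (a := 0) hq ht hy hh
  have shift_both : qPairing q t (fun n => h (n + 1)) (fun n => g (n + 1)) =
      2 * x * qPairing q t h (fun n => g (n + 1)) - t * qPairing q t h fun n => g (n + 2) := by
    simpa using qPairing_littleH_succ (a := 0) hq ht hx hg.comp_succ
  have shift_g_twice : qPairing q t h (fun n => g (n + 2)) =
      2 * y * qPairing q t h (fun n => g (n + 1))
        - (qPairing q t h g - q * qPairing q (t * q) h g) := by
    simpa [qPairing_comm q _ _ h] using qPairing_littleH_add_two (a := 0) hq ht hy hh
  have scale_t := qPairing_mul_q hq ht hh hg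
  simp only [bilinearSum, w]
  linear_combination -(1 - t ^ 2) * (scale_t - t * shift_both + t ^ 2 * shift_g_twice)
    + 2 * t * (x - y * t) * (shift_g - t * shift_h)

lemma bilinearSum_eq_tprod_v_mul (a : ℝ) :
    bilinearSum q t a (t * a) x y =
      (∏' k : ℕ, v y (t * a * q ^ k)) * bilinearSum q t 0 0 x y := by
  have hstep (k : ℕ) : bilinearSum q t (a * q ^ k) (t * a * q ^ k) x y =
      v y (t * a * q ^ k) * bilinearSum q t (a * q ^ (k + 1)) (t * a * q ^ (k + 1)) x y := by
    simpa only [pow_succ, mul_assoc] using bilinearSum_eq_v_mul hq ht hx hy (a * q ^ k)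
  have hlim := tendsto_bilinearSum hq ht hx hy tendsto_const_nhds
    (tendsto_const_mul_pow hq a) (tendsto_const_mul_pow hq (t * a))
  simpa only [pow_zero, mul_one] using
    eq_tprod_mul_of_eq_mul_succ (multipliable_v hq y (t * a)) hstep hlim

lemma bilinearSum_zero_zero_eq_tprod :
    bilinearSum q t 0 0 x y = qPochhammerInf (t ^ 2) q * ∏' k : ℕ, (w x y (t * q ^ k))⁻¹ := by
  have hsq := (multipliable_one_sub_mul_pow_even hq (t ^ 2)).mul
    (multipliable_one_sub_mul_pow_odd hq (t ^ 2))
  have hw := multipliable_w_inv hq x y t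
  have hstep (k : ℕ) : bilinearSum q (t * q ^ k) 0 0 x y =
      (1 - t ^ 2 * q ^ (2 * k)) * (1 - t ^ 2 * q ^ (2 * k + 1)) * (w x y (t * q ^ k))⁻¹ *
        bilinearSum q (t * q ^ (k + 1)) 0 0 x y := by
    have htk : |t * q ^ k| < 1 := (abs_mul_pow_le hq.le t k).trans_lt ht
    rw [mul_right_comm, ← div_eq_mul_inv, eq_div_iff (w_pos hx hy htk).ne', mul_comm,
      w_mul_bilinearSum_zero_zero hq htk hx hy]
    ring_nf
  have hlim : Tendsto (fun k : ℕ => bilinearSum q (t * q ^ k) 0 0 x y) atTop (𝓝 1) := by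
    have hzero : bilinearSum q 0 0 0 x y = 1 := by simp [bilinearSum, qPairing_zero_left, littleH]
    rw [← hzero]
    exact tendsto_bilinearSum hq (by simp) hx hy (tendsto_const_mul_pow hq t)
      tendsto_const_nhds tendsto_const_nhds
  have hprod := eq_tprod_mul_of_eq_mul_succ (hsq.mul hw) hstep hlim
  rwa [pow_zero, mul_one, mul_one, hsq.tprod_mul hw,
    ← qPochhammerInf_eq_tprod_even_mul_odd hq] at hprod

theorem bilinearSum_eq_qPochhammerInf_mul_tprod (a : ℝ) :
    bilinearSum q t a (t * a) x y =
      qPochhammerInf (t ^ 2) q * ∏' k : ℕ, v y (t * a * q ^ k) / w x y (t * q ^ k) := by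
  simp only [div_eq_mul_inv]
  rw [bilinearSum_eq_tprod_v_mul hq ht hx hy, bilinearSum_zero_zero_eq_tprod hq ht hx hy,
    (multipliable_v hq y (t * a)).tprod_mul (multipliable_w_inv hq x y t), mul_left_comm]

end BilinearSum

/-! ### Rescaling to `S(q)` -/

lemma abs_div_lt_one {a b : ℝ} (hab : |b| < |a|) : |b / a| < 1 := by
  rwa [abs_div, div_lt_one ((abs_nonneg b).trans_lt hab)]

lemma abs_mul_sqrt_div_two_le_one {q x : ℝ} (hq : q < 1) (hx : x ∈ S q) :
    |x * √(1 - q) / 2| ≤ 1 := by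
  have hsqrt : 0 < √(1 - q) := Real.sqrt_pos.2 (sub_pos.2 hq)
  obtain ⟨hx₁, hx₂⟩ := hx
  rw [div_le_iff₀ hsqrt] at hx₁
  rw [le_div_iff₀ hsqrt] at hx₂
  exact abs_le.2 ⟨by linarith, by linarith⟩

lemma qFactorial_mul_pow (q : ℝ) (n : ℕ) :
    qFactorial q n * (1 - q) ^ n = ∏ j ∈ Finset.range n, (1 - q ^ (j + 1)) := by
  rw [qFactorial, ← Finset.card_range n, ← Finset.prod_const, Finset.card_range,
    ← Finset.prod_mul_distrib]
  exact Finset.prod_congr rfl fun j _ => geom_sum_mul_neg q (j + 1)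

lemma kernelTerm_eq_qExpCoeff_mul {q : ℝ} (hq : q < 1) (a b x y : ℝ) (n : ℕ) :
    kernelTerm q a b x y n = qExpCoeff q (b / a) n *
      (littleH (a * √(1 - q)) q (x * √(1 - q) / 2) n *
        littleH (b * √(1 - q)) q (y * √(1 - q) / 2) n) := by
  have hsqrt : (√(1 - q) ^ n)⁻¹ * (√(1 - q) ^ n)⁻¹ = ((1 - q) ^ n)⁻¹ := by
    rw [← mul_inv, ← mul_pow, Real.mul_self_sqrt (sub_pos.2 hq).le]
  rw [kernelTerm, bigH, bigH, qExpCoeff, ← qFactorial_mul_pow, div_pow]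
  simp only [div_eq_mul_inv, mul_inv, ← hsqrt]
  ring

lemma hasSum_kernelTerm {q a b x y : ℝ} (hq : |q| < 1) (hab : |b| < |a|) (hx : x ∈ S q)
    (hy : y ∈ S q) :
    HasSum (kernelTerm q a b x y) (qPochhammerInf (b ^ 2 / a ^ 2) q *
      ∏' k : ℕ, V q y (b * q ^ k) / W q x y (b / a * q ^ k)) := by
  have hq1 : q < 1 := (le_abs_self q).trans_lt hq
  have hx' := abs_mul_sqrt_div_two_le_one hq1 hx
  have hy' := abs_mul_sqrt_div_two_le_one hq1 hy
  have ht := abs_div_lt_one hab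
  have hb : b / a * (a * √(1 - q)) = b * √(1 - q) := by
    rw [← mul_assoc, div_mul_cancel₀ b (abs_pos.1 ((abs_nonneg b).trans_lt hab))]
  have hsum := hasSum_qPairing hq ht (polynomiallyBounded_littleH hq (a * √(1 - q)) hx')
    (polynomiallyBounded_littleH hq (b * √(1 - q)) hy')
  have hclosed := bilinearSum_eq_qPochhammerInf_mul_tprod hq ht hx' hy' (a * √(1 - q))
  rw [hb, bilinearSum] at hclosed
  rw [hclosed, div_pow] at hsum
  simpa only [V, W, mul_right_comm b, ← kernelTerm_eq_qExpCoeff_mul hq1] using hsum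

lemma multipliable_V_div_W {q : ℝ} (hq : |q| < 1) (x y b t : ℝ) :
    Multipliable fun k : ℕ => V q y (b * q ^ k) / W q x y (t * q ^ k) := by
  simpa only [V, W, mul_right_comm b, div_eq_mul_inv] using
    (multipliable_v hq _ (b * √(1 - q))).mul (multipliable_w_inv hq _ _ t)

lemma V_nonneg {q y : ℝ} (hq : q < 1) (hy : y ∈ S q) (c : ℝ) : 0 ≤ V q y c :=
  v_nonneg (abs_mul_sqrt_div_two_le_one hq hy) _

lemma W_pos {q x y t : ℝ} (hq : q < 1) (hx : x ∈ S q) (hy : y ∈ S q) (ht : |t| < 1) :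
    0 < W q x y t :=
  w_pos (abs_mul_sqrt_div_two_le_one hq hx) (abs_mul_sqrt_div_two_le_one hq hy) ht

end BigQHermite

theorem mainTheorem3 (q a b x y : ℝ) (hq : |q| < 1) (hab : |b| < |a|)
    (hx : x ∈ BigQHermite.S q) (hy : y ∈ BigQHermite.S q) :
    -- the closed form is meaningful: denominators do not vanish, the products converge
    (∀ k : ℕ, BigQHermite.W q x y (b / a * q ^ k) ≠ 0) ∧
    Multipliable (fun k : ℕ => 1 - b ^ 2 / a ^ 2 * q ^ k) ∧
    Multipliable (fun k : ℕ =>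
      BigQHermite.V q y (b * q ^ k) / BigQHermite.W q x y (b / a * q ^ k)) ∧
    -- the kernel converges, is nonnegative, and has the closed form
    Summable (BigQHermite.kernelTerm q a b x y) ∧
    0 ≤ ∑' n : ℕ, BigQHermite.kernelTerm q a b x y n ∧
    ∑' n : ℕ, BigQHermite.kernelTerm q a b x y n =
      BigQHermite.qPochhammerInf (b ^ 2 / a ^ 2) q *
        ∏' k : ℕ, BigQHermite.V q y (b * q ^ k) / BigQHermite.W q x y (b / a * q ^ k) := by
  have hq1 : q < 1 := (le_abs_self q).trans_lt hq
  have ht : |b / a| < 1 := BigQHermite.abs_div_lt_one hab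
  have hW (k : ℕ) : 0 < BigQHermite.W q x y (b / a * q ^ k) :=
    BigQHermite.W_pos hq1 hx hy ((BigQHermite.abs_mul_pow_le hq.le _ k).trans_lt ht)
  have hsum := BigQHermite.hasSum_kernelTerm hq hab hx hy
  have ht2 : |b ^ 2 / a ^ 2| ≤ 1 := by
    rw [← div_pow, abs_pow]; exact pow_le_one₀ (abs_nonneg _) ht.le
  have hnonneg : 0 ≤ BigQHermite.qPochhammerInf (b ^ 2 / a ^ 2) q *
      ∏' k : ℕ, BigQHermite.V q y (b * q ^ k) / BigQHermite.W q x y (b / a * q ^ k) :=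
    mul_nonneg (BigQHermite.qPochhammerInf_nonneg ht2 hq.le)
      (tprod_nonneg fun k => div_nonneg (BigQHermite.V_nonneg hq1 hy _) (hW k).le)
  exact ⟨fun k => (hW k).ne', BigQHermite.multipliable_one_sub_mul_pow hq _,
    BigQHermite.multipliable_V_div_W hq x y b (b / a), hsum.summable,
    hnonneg.trans_eq hsum.tsum_eq.symm, hsum.tsum_eq⟩
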